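/- Theorem. Let $N=\{1,\dots,n\}$ with $n\ge 2$ be a set of voters, partitioned into groups $N_1,\dots,N_g$, let $G=\{1,\dots,g\}$, and let $P=\{p_1,\dots,p_m\}$, $m\ge 1$, be a set of projects ordered by $p_1\triangleleft\cdots\triangleleft p_m$. Let $\mathcal D$ be the set of all linear orders $\succ$ on $P$ that are single-peaked: if $\mathrm{top}(\succ)$ denotes the best project of $\succ$, then $p\succ p'$ whenever $\mathrm{top}(\succ)\triangleleft p\triangleleft p'$ or $p'\triangleleft p\triangleleft \mathrm{top}(\succ)$. Let $\Delta P$ be the set of probability distributions on $P$; for $\delta\in\Delta P$ and $A\subseteq P$ write $\delta(A)=\sum_{p\in A}\delta(p)$, and put $[p_1,p_0]=\emptyset$. For every $q\in G$ let $\kappa_q\in\{1,\dots,m\}$ and $\eta_q\in[0,1]$, and let $\psi_q:\mathcal D^{N_q}\to 2^P$ be such that, for every profile $R\in\mathcal D^{N_q}$, the set $\psi_q(R)$ consists of $\kappa_q$ consecutive projects and contains a project $p$ with $\mathrm{top}(R_i)\trianglelefteq p\trianglelefteq \mathrm{top}(R_j)$ for some $i,j\in N_q$. For integers $z_1,z_2\ge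 0$, a project $p$ is feasible at $(z_1,z_2;\psi_q)$ if there is $R\in\mathcal D^{N_q}$ such that $p=\min\psi_q(R)$, exactly $z_1$ voters $i\in N_q$ have $\mathrm{top}(R_i)\triangleleft\min\psi_q(R)$, and exactly $|N_q|-z_2$ voters $i\in N_q$ have $\max\psi_q(R)\triangleleft\mathrm{top}(R_i)$. A random rule is a map $\varphi:\mathcal D^{N}\to\Delta P$. It is (a) unanimous if $\varphi(R)(p)=1$ whenever $\mathrm{top}(R_i)=p$ for all $i\in N$; (b) strategy-proof if for all $R\in\mathcal D^N$, $i\in N$, $R_i'\in\mathcal D$ and $p\in P$, with $U$ the set of projects that are at least as good as $p$ according to $R_i$, we have $\varphi(R)(U)\ge\varphi(R_i',R_{-i})(U)$; (c) group-wise anonymous if $\varphi(R)=\varphi(R\circ\pi)$ for all $R\in\mathcal D^N$ and every permutation $\pi$ of $N$ that maps each group $N_q$ to itself; (d) satisfies the $(\kappa_G,\psi_G,\eta_G)$-weak group entitlement guarantee if $\varphi(R)\big(\psi_q(R|_{N_q})\big)\ge\eta_q$ for all $R\in\mathcal D^N$ and $q\in G$. Let $\Gamma=\prod_{q\in G}\{0,\dots,|N_q|\}$,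 and write $\gamma\gg\gamma'$ if $\gamma_q\ge\gamma'_q$ for all $q\in G$. For $R\in\mathcal D^N$ and $0\le t\le m$ let $\alpha(t;R)\in\Gamma$ be the vector with coordinates $|\{i\in N_q:\mathrm{top}(R_i)\in\{p_1,\dots,p_t\}\}|$. The rule $\varphi$ is the probabilistic fixed group ballot rule with ballots $(\delta_\gamma)_{\gamma\in\Gamma}$, $\delta_\gamma\in\Delta P$, if $\delta_{(0,\dots,0)}(p_m)=1$ and $\delta_{(|N_1|,\dots,|N_g|)}(p_1)=1$; if $\gamma\gg\gamma'$ implies $\delta_\gamma([p_1,p_t])\ge\delta_{\gamma'}([p_1,p_t])$ for all $t\in\{1,\dots,m\}$; and if for all $R\in\mathcal D^N$ and $t\in\{1,\dots,m\}$ $$\varphi(R)(p_t)=\delta_{\alpha(t;R)}([p_1,p_t])-\delta_{\alpha(t-1;R)}([p_1,p_{t-1}]).$$ Then a random rule $\varphi$ is unanimous, strategy-proof, group-wise anonymous and satisfies the $(\kappa_G,\psi_G,\eta_G)$-weak group entitlement guarantee if and only if there are ballots $(\delta_\gamma)_{\gamma\in\Gamma}$ such that $\varphi$ is the probabilistic fixed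 group ballot rule with these ballots and, for all $q\in G$, all $\gamma,\gamma'\in\Gamma$ with $\gamma\gg\gamma'$, and all $p_x\in P$ feasible at $(\gamma'_q,\gamma_q;\psi_q)$, $$\delta_\gamma([p_1,p_{x+\kappa_q-1}])-\delta_{\gamma'}([p_1,p_{x-1}])\ge\eta_q.$$ -/

import Mathlib

/-! Projects `p_1, …, p_m` are the elements of `Fin m` with its usual order as the prior ordering;
the project `p_t` is the element of `Fin m` with value `t - 1`. Voters are the elements of `Fin n`. -/

/-- A strictly ordinal preference on the projects: a complete, reflexive, antisymmetric and
transitive relation. `weak p p'` means that `p` is at least as good as `p'`. -/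
structure StrictPref (m : ℕ) where
  weak : Fin m → Fin m → Prop
  refl : ∀ p, weak p p
  total : ∀ p p', weak p p' ∨ weak p' p
  antisymm : ∀ p p', weak p p' → weak p' p → p = p'
  trans : ∀ p p' p'', weak p p' → weak p' p'' → weak p p''

namespace StrictPref

/-- `p` is strictly preferred over `p'`. -/
def Strict {m : ℕ} (R : StrictPref m) (p p' : Fin m) : Prop := R.weak p p' ∧ p ≠ p'

theorem exists_top {m : ℕ} [NeZero m] (R : StrictPref m) : ∃ p, ∀ p', ¬ R.Strict p' p := by
  have key : ∀ s : Finset (Fin m), s.Nonempty → ∃ p ∈ s, ∀ p' ∈ s, R.weak p p' := by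
    intro s hs
    induction hs using Finset.Nonempty.cons_induction with
    | singleton a => exact ⟨a, by simp, by simpa using R.refl a⟩
    | cons a s ha hs ih =>
      obtain ⟨p, hp, hmax⟩ := ih
      rcases R.total a p with h | h
      · refine ⟨a, by simp, fun p' hp' => ?_⟩
        rcases Finset.mem_cons.1 hp' with rfl | h'
        · exact R.refl _
        · exact R.trans _ _ _ h (hmax _ h')
      · refine ⟨p, by simp [hp], fun p' hp' => ?_⟩
        rcases Finset.mem_cons.1 hp' with rfl | h'
        · exact h
        · exact hmax _ h'
  obtain ⟨p, -, hp⟩ := key Finset.univ ⟨0, Finset.mem_univ _⟩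
  exact ⟨p, fun p' h => h.2 (R.antisymm _ _ h.1 (hp p' (Finset.mem_univ _)))⟩

/-- The top-ranked project (the peak): the unique one to which no project is strictly preferred. -/
noncomputable def top {m : ℕ} [NeZero m] (R : StrictPref m) : Fin m := R.exists_top.choose

open Classical in
/-- The upper contour set of `p`: the projects that are as good as `p`. -/
noncomputable def upper {m : ℕ} (R : StrictPref m) (p : Fin m) : Finset (Fin m) :=
  Finset.univ.filter fun p' => p' = p ∨ R.Strict p' p

/-- Single-peakedness with respect to the prior ordering. -/
def SinglePeaked {m : ℕ} [NeZero m] (R : StrictPref m) : Prop :=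
  ∀ p p' : Fin m, (R.top < p ∧ p < p') ∨ (p' < p ∧ p < R.top) → R.Strict p p'

end StrictPref

/-- The domain of all single-peaked preferences. -/
def SPPref (m : ℕ) [NeZero m] : Type := {R : StrictPref m // R.SinglePeaked}

/-- The top-ranked project of a single-peaked preference. -/
noncomputable def SPPref.top {m : ℕ} [NeZero m] (R : SPPref m) : Fin m := R.1.top

/-- The set of probability distributions over the projects. -/
abbrev Lottery (m : ℕ) : Type := stdSimplex ℝ (Fin m)

/-- The probability of a set of projects. -/
noncomputable def Lottery.prob {m : ℕ} (d : Lottery m) (A : Finset (Fin m)) : ℝ := ∑ p ∈ A, d.1 p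

/-- The probability of `[p_1, p_k] = {p_1, …, p_k}`; it is `0` for `k = 0`. -/
noncomputable def Lottery.cum {m : ℕ} (d : Lottery m) (k : ℕ) : ℝ :=
  d.prob (Finset.univ.filter fun p => (p : ℕ) < k)

/-- A random social choice rule on the single-peaked domain. -/
abbrev RSCR (n m : ℕ) [NeZero m] : Type := (Fin n → SPPref m) → Lottery m

/-- `d` stochastically dominates `d'` with respect to the preference `R`. -/
def StochDominates {m : ℕ} [NeZero m] (R : SPPref m) (d d' : Lottery m) : Prop :=
  ∀ p : Fin m, d'.prob (R.1.upper p) ≤ d.prob (R.1.upper p)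

namespace RSCR

def Unanimous {n m : ℕ} [NeZero m] (φ : RSCR n m) : Prop :=
  ∀ (p : Fin m) (R : Fin n → SPPref m), (∀ i, (R i).top = p) → (φ R).1 p = 1

def StrategyProof {n m : ℕ} [NeZero m] (φ : RSCR n m) : Prop :=
  ∀ (i : Fin n) (R : Fin n → SPPref m) (R' : SPPref m),
    StochDominates (R i) (φ R) (φ (Function.update R i R'))

end RSCR

/-- A partition `(N_1, …, N_g)` of the voters into groups. -/
structure VoterPartition (n g : ℕ) where
  part : Fin g → Finset (Fin n)
  cover : ∀ i : Fin n, ∃ q, i ∈ part q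
  disjoint : ∀ q r : Fin g, q ≠ r → Disjoint (part q) (part r)

/-- Permuting the preferences within the groups does not change the outcome. -/
def RSCR.GroupAnonymous {n m g : ℕ} [NeZero m] (φ : RSCR n m) (𝒩 : VoterPartition n g) : Prop :=
  ∀ π : Equiv.Perm (Fin n), (∀ q, ∀ i ∈ 𝒩.part q, π i ∈ 𝒩.part q) →
    ∀ R : Fin n → SPPref m, φ R = φ (fun i => R (π i))

/-- A representative function of a group `V` of voters. -/
abbrev RepFun (V : Type) (m : ℕ) [NeZero m] : Type := (V → SPPref m) → Finset (Fin m)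

/-- Some selected project lies weakly between two top-ranked projects of the group. -/
def RepFun.TopRanged {V : Type} {m : ℕ} [NeZero m] (ψ : RepFun V m) : Prop :=
  ∀ R : V → SPPref m, ∃ p ∈ ψ R, ∃ i j : V, (R i).top ≤ p ∧ p ≤ (R j).top

/-- A representation scenario: a representative function for every group. -/
abbrev RepScenario {n g : ℕ} (𝒩 : VoterPartition n g) (m : ℕ) [NeZero m] : Type :=
  (q : Fin g) → RepFun {i : Fin n // i ∈ 𝒩.part q} m

/-- Every representative function is top-ranged and always selects an interval of size `κ q`. -/
def RepScenario.Compliant {n g m : ℕ} [NeZero m] {𝒩 : VoterPartition n g}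
    (ψ : RepScenario 𝒩 m) (κ : Fin g → ℕ) : Prop :=
  ∀ q, (ψ q).TopRanged ∧
    ∀ R, (∃ a b : Fin m, ψ q R = Finset.uIcc a b) ∧ (ψ q R).card = κ q

/-- The project `p` is feasible at `(z₁, z₂; ψ)`: at some profile of the group, `p` is the minimum
of the selected set, exactly `z₁` voters of the group have their peaks before the minimum, and
exactly `|V| - z₂` voters have their peaks after the maximum `b`. -/
def RepFun.Feasible {V : Type} [Fintype V] {m : ℕ} [NeZero m] (ψ : RepFun V m) (z₁ z₂ : ℕ)
    (p : Fin m) : Prop :=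
  ∃ (R : V → SPPref m) (b : Fin m),
    IsLeast (ψ R : Set (Fin m)) p ∧ IsGreatest (ψ R : Set (Fin m)) b ∧
    (Finset.univ.filter fun i : V => (R i).top < p).card = z₁ ∧
    (Finset.univ.filter fun i : V => b < (R i).top).card + z₂ = Fintype.card V

/-- Weak group entitlement guarantee: the representatives of every group together always receive
at least the reservation quota of the group. -/
def RSCR.WeakGEG {n m g : ℕ} [NeZero m] (φ : RSCR n m) {𝒩 : VoterPartition n g}
    (ψ : RepScenario 𝒩 m) (η : Fin g → ℝ) : Prop :=
  ∀ (R : Fin n → SPPref m) (q : Fin g), η q ≤ (φ R).prob (ψ q fun i => R i.1)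

/-- The set `Γ` of vectors `γ` with `γ_q ∈ {0, …, |N_q|}`. -/
abbrev GroupCounts {n g : ℕ} (𝒩 : VoterPartition n g) : Type :=
  (q : Fin g) → Fin ((𝒩.part q).card + 1)

/-- `γ ≫ γ'`: weak dominance in every coordinate. -/
def GroupCounts.Dominates {n g : ℕ} {𝒩 : VoterPartition n g} (γ γ' : GroupCounts 𝒩) : Prop :=
  ∀ q, γ' q ≤ γ q

/-- `α(t; R)`: the number of voters in each group with peak among `p_1, …, p_t`. -/
noncomputable def peakCounts {n g m : ℕ} [NeZero m] (𝒩 : VoterPartition n g) (t : ℕ)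
    (R : Fin n → SPPref m) : GroupCounts 𝒩 := fun q =>
  ⟨((𝒩.part q).filter fun i => ((R i).top : ℕ) < t).card,
    Nat.lt_succ_of_le (Finset.card_filter_le _ _)⟩

/-- `φ` is the probabilistic fixed group ballot rule given by the ballots `δ`. -/
structure RSCR.IsGroupBallotRule {n m g : ℕ} [NeZero m] (φ : RSCR n m) (𝒩 : VoterPartition n g)
    (δ : GroupCounts 𝒩 → Lottery m) : Prop where
  /-- Ballot unanimity for the zero vector and `p_m`. -/
  unanimity_bot : (δ fun _ => 0).1 ⟨m - 1, Nat.sub_one_lt (NeZero.ne m)⟩ = 1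
  /-- Ballot unanimity for the vector of group sizes and `p_1`. -/
  unanimity_top : (δ fun _ => Fin.last _).1 ⟨0, Nat.pos_of_ne_zero (NeZero.ne m)⟩ = 1
  monotone : ∀ γ γ' : GroupCounts 𝒩, γ.Dominates γ' → ∀ t : ℕ, 1 ≤ t → t ≤ m →
    (δ γ').cum t ≤ (δ γ).cum t
  /-- The probability of the project `p`, which is `p_t` for `t = p + 1`. -/
  outcome : ∀ (R : Fin n → SPPref m) (p : Fin m),
    (φ R).1 p = (δ (peakCounts 𝒩 (p + 1) R)).cum (p + 1) - (δ (peakCounts 𝒩 p R)).cum p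

/-! Everything is read off the cumulative probabilities `(φ R).cum t`, which determine a lottery.
For a unanimous and strategy-proof rule the outcome depends only on the peaks
(`RSCR.Unanimous.tops_only`). Two preferences with the same peak are linked by swaps of adjacent
projects lying on opposite sides of it. Such a swap can only shift probability between the two
projects, and the shift is unaffected when the other voters are moved to the swapper's peak; there
unanimity makes it zero. Once only peaks matter, a voter's preference may be replaced by one with
the same peak that has `[p_1, p_t]` or its complement as an upper contour set. Strategy-proofness
then makes `cum t` monotone in the set of voters with peak in `[p_1, p_t]`
(`RSCR.Unanimous.cum_le`), and group anonymity reduces this set to its counts per group. A profile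
with peaks only at `p_1` and `p_m` has the same counts `γ` for every `0 < t < m`, so its outcome
serves as the ballot `δ_γ`. Conversely, the outcome formula telescopes to `cum t` of the ballot at
`α(t; R)`. Upper contour sets are intervals around the peak, so ballot monotonicity gives
strategy-proofness. The probability of a represented interval is a difference of two cumulative
values. Feasibility describes the pairs of counts that the group itself can produce at its ends, and
the other groups can be given any counts compatible with `γ ≫ γ'`. Thus the guarantee and the ballot
inequalities coincide. -/

namespace StrictPref

/-! ### Upper contour sets of linear orders. -/

variable {m : ℕ} [NeZero m]

theorem weak_top (R : StrictPref m) (p : Fin m) : R.weak R.top p := by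
  by_contra h
  have hp : R.weak p R.top := (R.total _ _).resolve_right h
  refine R.exists_top.choose_spec p ⟨hp, ?_⟩
  rintro hpt
  exact h (hpt ▸ R.refl _)

theorem eq_top (R : StrictPref m) {p : Fin m} (h : ∀ p', R.weak p p') : R.top = p :=
  R.antisymm _ _ (R.weak_top p) (h _)

omit [NeZero m] in
theorem mem_upper (R : StrictPref m) {p p' : Fin m} : p' ∈ R.upper p ↔ R.weak p' p := by
  classical
  rw [upper, Finset.mem_filter]
  simp only [Strict, Finset.mem_univ, true_and]
  constructor
  · rintro (rfl | h)
    · exact R.refl _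
    · exact h.1
  · intro h
    by_cases hp : p' = p
    · exact Or.inl hp
    · exact Or.inr ⟨h, hp⟩

theorem upper_top (R : StrictPref m) : R.upper R.top = {R.top} := by
  ext p
  rw [mem_upper, Finset.mem_singleton]
  exact ⟨fun h => R.antisymm _ _ h (R.weak_top p), fun h => h ▸ R.refl _⟩

/-- Every preference other than at the top has an immediate predecessor. -/
theorem exists_upper_eq_insert (R : StrictPref m) {c : Fin m} (hc : c ≠ R.top) :
    ∃ d, ¬ R.weak c d ∧ R.upper c = insert c (R.upper d) := by
  classical
  -- The worst project strictly above `c` is the one with the largest upper contour set.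
  obtain ⟨d, hd, hmax⟩ := Finset.exists_max_image ((R.upper c).erase c)
    (fun p => (R.upper p).card)
    ⟨R.top, by rw [Finset.mem_erase, mem_upper]; exact ⟨hc.symm, R.weak_top c⟩⟩
  rw [Finset.mem_erase, mem_upper] at hd
  have hcd : ¬ R.weak c d := fun h => hd.1 (R.antisymm _ _ hd.2 h)
  refine ⟨d, hcd, ?_⟩
  ext p
  rw [Finset.mem_insert, mem_upper, mem_upper]
  constructor
  · intro hp
    by_contra! hne
    have h1 := hmax p (by rw [Finset.mem_erase, mem_upper]; exact ⟨hne.1, hp⟩)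
    have hdp : R.weak d p := (R.total _ _).resolve_right hne.2
    refine absurd h1 (not_le.2 (Finset.card_lt_card ⟨?_, ?_⟩))
    · intro r hr
      rw [mem_upper] at hr ⊢
      exact R.trans _ _ _ hr hdp
    · intro h
      exact hne.2 ((mem_upper R).1 (h ((mem_upper R).2 (R.refl p))))
  · rintro (rfl | h)
    · exact R.refl _
    · exact R.trans _ _ _ h hd.2

end StrictPref

/-! ### Single-peaked preferences: intervals as upper contour sets, and swaps. -/

namespace SPPref

variable {m : ℕ} [NeZero m]

/-- `U` is an upper contour set of `R`. -/
def IsUpper (R : SPPref m) (U : Finset (Fin m)) : Prop := ∃ p, R.1.upper p = U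

theorem isUpper_top (R : SPPref m) : R.IsUpper {R.top} := ⟨R.1.top, R.1.upper_top⟩

theorem weak_of_between (R : SPPref m) {p p' : Fin m}
    (h : (R.top ≤ p ∧ p ≤ p') ∨ (p' ≤ p ∧ p ≤ R.top)) : R.1.weak p p' := by
  by_cases h1 : R.1.top = p
  · exact h1 ▸ R.1.weak_top p'
  by_cases h2 : p = p'
  · exact h2 ▸ R.1.refl p
  refine (R.2 p p' ?_).1
  have h1' : R.top ≠ p := h1
  change (R.top < p ∧ p < p') ∨ (p' < p ∧ p < R.top)
  grind

theorem ordConnected_upper (R : SPPref m) (p : Fin m) :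
    (R.1.upper p : Set (Fin m)).OrdConnected := by
  refine ⟨fun a ha b hb c hc => ?_⟩
  simp only [Finset.mem_coe, StrictPref.mem_upper] at *
  rcases le_total R.top c with h | h
  · exact R.1.trans _ _ _ (R.weak_of_between (Or.inl ⟨h, hc.2⟩)) hb
  · exact R.1.trans _ _ _ (R.weak_of_between (Or.inr ⟨hc.1, h⟩)) ha

/-- Rank the projects of `U` before all others; within each block, go left from `c` first and then
right. As `U` is an interval around `c`, this order is single-peaked. -/
theorem exists_top_isUpper {c : Fin m} {U : Finset (Fin m)} (hc : c ∈ U)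
    (hU : (U : Set (Fin m)).OrdConnected) : ∃ R : SPPref m, R.top = c ∧ R.IsUpper U := by
  classical
  -- The penalty `m` exceeds every value inside `U`. Projects up to `c` get values at most `c` and
  -- those after it larger ones, so `f` is injective with minimum at `c`.
  let f : Fin m → ℕ := fun p =>
    (if p ∈ U then 0 else m) + if (p : ℕ) ≤ c then (c : ℕ) - p else p
  have hf : ∀ p p', f p = f p' → p = p' := by
    intro p p' h
    apply Fin.ext
    have := p.2; have := p'.2; have := c.2
    simp only [f] at h
    split_ifs at h <;> omega
  let R : StrictPref m :=
    { weak := fun p p' => f p ≤ f p'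
      refl := fun p => le_rfl
      total := fun p p' => le_total _ _
      antisymm := fun p p' h h' => hf _ _ (le_antisymm h h')
      trans := fun _ _ _ h h' => le_trans h h' }
  have htop : R.top = c := R.eq_top fun p' => by simp [R, f, hc]
  have hsp : R.SinglePeaked := by
    intro p p' h
    rw [htop] at h
    have hUU : p' ∈ U → p ∈ U := by
      intro hp'
      rcases h with h | h
      · exact hU.out hc hp' ⟨h.1.le, h.2.le⟩
      · exact hU.out hp' hc ⟨h.1.le, h.2.le⟩
    refine ⟨?_, by rcases h with h | h; exacts [h.2.ne, h.1.ne']⟩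
    have := p.2; have := p'.2; have := c.2
    simp only [Fin.lt_def] at h
    simp only [R, f]
    split_ifs <;> first | omega | (exfalso; tauto)
  refine ⟨⟨R, hsp⟩, htop, ?_⟩
  obtain ⟨p, hp, hmax⟩ := U.exists_max_image f ⟨c, hc⟩
  refine ⟨p, ?_⟩
  ext r
  rw [StrictPref.mem_upper]
  refine ⟨fun h => ?_, fun h => hmax r h⟩
  by_contra hr
  have h' : f r ≤ f p := h
  have := p.2; have := r.2; have := c.2
  simp only [f, hp, hr, if_true, if_false] at h'
  split_ifs at h' <;> omega

theorem exists_top (c : Fin m) : ∃ R : SPPref m, R.top = c := by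
  obtain ⟨R, h, -⟩ := exists_top_isUpper (Finset.mem_singleton_self c)
    (by simpa using Set.ordConnected_singleton)
  exact ⟨R, h⟩

theorem ne_top_of_swap {R : SPPref m} {a b : Fin m}
    (hs : (a < R.top ∧ R.top < b) ∨ (b < R.top ∧ R.top < a)) : a ≠ R.top ∧ b ≠ R.top ∧ a ≠ b := by
  grind

/-- Two adjacent projects on different sides of the peak can be swapped. -/
theorem exists_swap (R : SPPref m) {a b : Fin m} (hab : R.1.weak a b)
    (hs : (a < R.top ∧ R.top < b) ∨ (b < R.top ∧ R.top < a))
    (hadj : ∀ c, R.1.weak a c → R.1.weak c b → c = a ∨ c = b) :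
    ∃ R' : SPPref m, R'.top = R.top ∧ ∀ p p', R'.1.weak p p' ↔
      (R.1.weak p p' ∧ ¬ (p = a ∧ p' = b)) ∨ (p = b ∧ p' = a) := by
  obtain ⟨hat, hbt, hne⟩ := ne_top_of_swap hs
  have hrefl := R.1.refl
  have htot := R.1.total
  have hanti := R.1.antisymm
  have htrans := R.1.trans
  let Q : StrictPref m :=
    { weak := fun p p' => (R.1.weak p p' ∧ ¬ (p = a ∧ p' = b)) ∨ (p = b ∧ p' = a)
      refl := by grind
      total := by grind
      antisymm := by grind
      trans := by grind }
  have htop : Q.top = R.top := by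
    refine Q.eq_top fun p' => Or.inl ⟨R.1.weak_top p', ?_⟩
    rintro ⟨h, -⟩
    exact hat h.symm
  refine ⟨⟨Q, ?_⟩, htop, fun p p' => Iff.rfl⟩
  -- Single-peakedness only compares projects on one side of the peak, hence never `a` with `b`.
  intro p p' h
  rw [htop] at h
  refine ⟨Or.inl ⟨(R.2 p p' h).1, ?_⟩, (R.2 p p' h).2⟩
  rintro ⟨rfl, rfl⟩
  grind

end SPPref

/-! ### Cumulative probabilities. -/

namespace Lottery

variable {m : ℕ}

theorem nonneg (d : Lottery m) (p : Fin m) : 0 ≤ d.1 p := d.2.1 p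

theorem prob_univ (d : Lottery m) : d.prob Finset.univ = 1 := d.2.2

theorem prob_add_prob_compl (d : Lottery m) (A : Finset (Fin m)) : d.prob A + d.prob Aᶜ = 1 := by
  rw [prob, prob, Finset.sum_add_sum_compl]
  exact d.2.2

theorem eq_zero_of_eq_one (d : Lottery m) {p p' : Fin m} (hp : d.1 p = 1) (h : p' ≠ p) :
    d.1 p' = 0 := by
  have h1 := d.prob_add_prob_compl {p}
  rw [prob, Finset.sum_singleton, hp] at h1
  have h2 : d.1 p' ≤ d.prob {p}ᶜ :=
    Finset.single_le_sum (f := d.1) (fun q _ => d.nonneg q) (by simpa using h)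
  linarith [d.nonneg p']

theorem cum_zero (d : Lottery m) : d.cum 0 = 0 := by simp [cum, prob]

theorem cum_of_le (d : Lottery m) {t : ℕ} (ht : m ≤ t) : d.cum t = 1 := by
  rw [cum, Finset.filter_true_of_mem fun p _ => p.2.trans_le ht, prob_univ]

theorem cum_succ (d : Lottery m) (p : Fin m) : d.cum (p + 1) = d.cum p + d.1 p := by
  have : (Finset.univ.filter fun q : Fin m => (q : ℕ) < p + 1) =
      insert p (Finset.univ.filter fun q : Fin m => (q : ℕ) < p) := by
    ext q
    simp only [Finset.mem_filter, Finset.mem_univ, true_and, Finset.mem_insert, Fin.ext_iff]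
    omega
  rw [cum, cum, prob, prob, this, Finset.sum_insert (by simp), add_comm]

theorem prob_Icc (d : Lottery m) {a b : Fin m} (hab : a ≤ b) :
    d.prob (Finset.Icc a b) = d.cum (b + 1) - d.cum a := by
  have : (Finset.univ.filter fun q : Fin m => (q : ℕ) < b + 1) =
      (Finset.univ.filter fun q : Fin m => (q : ℕ) < a) ∪ Finset.Icc a b := by
    ext q
    simp only [Finset.mem_filter, Finset.mem_univ, true_and, Finset.mem_union, Finset.mem_Icc,
      Fin.le_def] at *
    omega
  have hd : Disjoint (Finset.univ.filter fun q : Fin m => (q : ℕ) < a) (Finset.Icc a b) := by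
    rw [Finset.disjoint_left]
    intro q hq hq'
    simp only [Finset.mem_filter, Finset.mem_univ, true_and, Finset.mem_Icc, Fin.le_def] at hq hq'
    omega
  rw [cum, cum, prob, prob, prob, this, Finset.sum_union hd]
  ring

theorem cum_eq_one (d : Lottery m) {p : Fin m} (hp : d.1 p = 1) {t : ℕ} (h : (p : ℕ) < t) :
    d.cum t = 1 := by
  rw [cum, prob, ← hp]
  refine Finset.sum_eq_single p (fun q _ hq => d.eq_zero_of_eq_one hp hq) fun hn => ?_
  exact absurd (Finset.mem_filter_univ p |>.2 h) hn

theorem cum_eq_zero (d : Lottery m) {p : Fin m} (hp : d.1 p = 1) {t : ℕ} (h : t ≤ (p : ℕ)) :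
    d.cum t = 0 := by
  rw [cum, prob]
  refine Finset.sum_eq_zero fun q hq => d.eq_zero_of_eq_one hp ?_
  rintro rfl
  exact absurd (Finset.mem_filter.1 hq).2 (not_lt.2 h)

theorem ext_cum {d d' : Lottery m} (h : ∀ t ≤ m, d.cum t = d'.cum t) : d = d' := by
  refine Subtype.ext (funext fun p => ?_)
  have h1 := d.cum_succ p
  have h2 := d'.cum_succ p
  rw [h _ p.2, h _ p.2.le] at h1
  linarith

end Lottery

/-! ### Unanimity and strategy-proofness imply dependence on peaks only. -/

namespace RSCR

open Function

variable {n m : ℕ} [NeZero m] {φ : RSCR n m}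

theorem StrategyProof.prob_le (hφ : φ.StrategyProof) {R : Fin n → SPPref m} {i : Fin n}
    {Q Q' : SPPref m} {U : Finset (Fin m)} (hU : Q.IsUpper U) :
    (φ (update R i Q')).prob U ≤ (φ (update R i Q)).prob U := by
  obtain ⟨p, rfl⟩ := hU
  have h := hφ i (update R i Q) Q' p
  rwa [update_self, update_idem] at h

/-- Neither preference may gain on a common upper contour set by reporting the other. -/
theorem StrategyProof.prob_eq (hφ : φ.StrategyProof) {R : Fin n → SPPref m} {i : Fin n}
    {Q Q' : SPPref m} {U : Finset (Fin m)} (hU : Q.IsUpper U) (hU' : Q'.IsUpper U) :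
    (φ (update R i Q)).prob U = (φ (update R i Q')).prob U :=
  le_antisymm (hφ.prob_le hU') (hφ.prob_le hU)

section Swap

variable {P P' : SPPref m} {a b : Fin m} {i : Fin n}

/-- Swapping two adjacent projects changes only their probabilities, and not the sum of these. -/
theorem StrategyProof.swap_eq (hφ : φ.StrategyProof) (hab : P.1.weak a b)
    (hs : (a < P.top ∧ P.top < b) ∨ (b < P.top ∧ P.top < a))
    (hadj : ∀ c, P.1.weak a c → P.1.weak c b → c = a ∨ c = b)
    (hP' : ∀ p p', P'.1.weak p p' ↔ (P.1.weak p p' ∧ ¬ (p = a ∧ p' = b)) ∨ (p = b ∧ p' = a))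
    (R : Fin n → SPPref m) :
    (∀ c, c ≠ a → c ≠ b → (φ (update R i P)).1 c = (φ (update R i P')).1 c) ∧
    (φ (update R i P)).1 a + (φ (update R i P)).1 b =
      (φ (update R i P')).1 a + (φ (update R i P')).1 b := by
  obtain ⟨hat, hbt, hne⟩ := SPPref.ne_top_of_swap hs
  have hrefl := P.1.refl
  have htot := P.1.total
  have hanti := P.1.antisymm
  have htrans := P.1.trans
  -- Only the upper contour set of `a` is lost by the swap; the one closed by `b` is now closed by
  -- `a`.
  have hU : ∀ p, p ≠ a → P'.IsUpper (P.1.upper p) := by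
    intro p hp
    refine ⟨if p = b then a else p, ?_⟩
    ext r
    rw [StrictPref.mem_upper, StrictPref.mem_upper, hP']
    split_ifs <;> grind
  have key : ∀ p, p ≠ a →
      (φ (update R i P)).prob (P.1.upper p) = (φ (update R i P')).prob (P.1.upper p) :=
    fun p hp => hφ.prob_eq ⟨p, rfl⟩ (hU p hp)
  constructor
  · intro c hca hcb
    by_cases hct : c = P.1.top
    · have := key c hca
      rw [hct, StrictPref.upper_top] at this
      simpa [Lottery.prob, hct] using this
    · obtain ⟨d, hcd, hd⟩ := P.1.exists_upper_eq_insert hct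
      have hc : c ∉ P.1.upper d := by rwa [StrictPref.mem_upper]
      have hmem : ∀ r, P.1.weak r c ↔ r = c ∨ P.1.weak r d := by
        intro r
        rw [← StrictPref.mem_upper, hd, Finset.mem_insert, StrictPref.mem_upper]
      -- The project right after `a` is `b`, so `a` does not immediately precede `c`, and both sets
      -- whose difference is `{c}` survive the swap.
      have hda : d ≠ a := by
        rintro rfl
        grind
      have h1 := key c hca
      have h2 := key d hda
      rw [hd, Lottery.prob, Lottery.prob, Finset.sum_insert hc, Finset.sum_insert hc] at h1
      rw [Lottery.prob, Lottery.prob] at h2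
      linarith
  · obtain ⟨d, hbd, hd⟩ := P.1.exists_upper_eq_insert hbt
    obtain ⟨e, hae, he⟩ := P.1.exists_upper_eq_insert hat
    have hmem : ∀ r, P.1.weak r b ↔ r = b ∨ P.1.weak r d := by
      intro r
      rw [← StrictPref.mem_upper, hd, Finset.mem_insert, StrictPref.mem_upper]
    have hmem' : ∀ r, P.1.weak r a ↔ r = a ∨ P.1.weak r e := by
      intro r
      rw [← StrictPref.mem_upper, he, Finset.mem_insert, StrictPref.mem_upper]
    have hda : d = a := by grind
    have hea : e ≠ a := by grind
    subst hda
    have h1 := key b hne.symm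
    have h2 := key e hea
    have hb : b ∉ insert d (P.1.upper e) := by
      rw [← he, StrictPref.mem_upper]
      exact hbd
    have ha : d ∉ P.1.upper e := by rwa [StrictPref.mem_upper]
    rw [hd, he, Lottery.prob, Lottery.prob, Finset.sum_insert hb, Finset.sum_insert hb,
      Finset.sum_insert ha, Finset.sum_insert ha] at h1
    rw [Lottery.prob, Lottery.prob] at h2
    linarith

omit [NeZero m] in
/-- A set that separates `a` from `b` detects the effect of a change that moves probability only
between `a` and `b`. -/
theorem prob_sub_prob {d d' : Lottery m} (hc : ∀ c, c ≠ a → c ≠ b → d.1 c = d'.1 c)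
    {U : Finset (Fin m)} (ha : a ∈ U) (hb : b ∉ U) : d.prob U - d'.prob U = d.1 a - d'.1 a := by
  rw [Lottery.prob, Lottery.prob, ← Finset.sum_sub_distrib]
  refine Finset.sum_eq_single a (fun c hcU hca => ?_) (fun h => absurd ha h)
  rw [hc c hca (by rintro rfl; exact hb hcU), sub_self]

/-- The probability of `U` is the same under `Q` and `Q'`, before and after the swap by `i`. As `U`
contains exactly one of `a` and `b`, it measures the shift between them, which is therefore the same
too. -/
theorem StrategyProof.swap_eq_swap (hφ : φ.StrategyProof)
    (hswap : ∀ R : Fin n → SPPref m,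
      (∀ c, c ≠ a → c ≠ b → (φ (update R i P)).1 c = (φ (update R i P')).1 c) ∧
      (φ (update R i P)).1 a + (φ (update R i P)).1 b =
        (φ (update R i P')).1 a + (φ (update R i P')).1 b)
    (R : Fin n → SPPref m) {j : Fin n} (hij : j ≠ i) {Q Q' : SPPref m} {U : Finset (Fin m)}
    (hQ : Q.IsUpper U) (hQ' : Q'.IsUpper U) (hU : (a ∈ U ∧ b ∉ U) ∨ (b ∈ U ∧ a ∉ U)) :
    (φ (update (update R j Q) i P)).1 a - (φ (update (update R j Q) i P')).1 a =
      (φ (update (update R j Q') i P)).1 a - (φ (update (update R j Q') i P')).1 a := by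
  have h1 : (φ (update (update R j Q) i P)).prob U = (φ (update (update R j Q') i P)).prob U := by
    rw [update_comm hij, update_comm hij]
    exact hφ.prob_eq hQ hQ'
  have h2 : (φ (update (update R j Q) i P')).prob U =
      (φ (update (update R j Q') i P')).prob U := by
    rw [update_comm hij, update_comm hij]
    exact hφ.prob_eq hQ hQ'
  obtain ⟨e1, e1'⟩ := hswap (update R j Q)
  obtain ⟨e2, e2'⟩ := hswap (update R j Q')
  rcases hU with ⟨ha, hb⟩ | ⟨hb, ha⟩
  · have f1 := prob_sub_prob e1 ha hb
    have f2 := prob_sub_prob e2 ha hb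
    linarith
  · have f1 := prob_sub_prob (fun c h h' => e1 c h' h) hb ha
    have f2 := prob_sub_prob (fun c h h' => e2 c h' h) hb ha
    linarith

/-- Any other voter can be moved to the peak `x` between `a` and `b` without altering the effect
of the swap. -/
theorem StrategyProof.exists_move (hφ : φ.StrategyProof)
    (hswap : ∀ R : Fin n → SPPref m,
      (∀ c, c ≠ a → c ≠ b → (φ (update R i P)).1 c = (φ (update R i P')).1 c) ∧
      (φ (update R i P)).1 a + (φ (update R i P)).1 b =
        (φ (update R i P')).1 a + (φ (update R i P')).1 b)
    {x : Fin m} (hs : (a < x ∧ x < b) ∨ (b < x ∧ x < a))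
    (R : Fin n → SPPref m) {j : Fin n} (hij : j ≠ i) :
    ∃ Q : SPPref m, Q.top = x ∧ (φ (update R i P)).1 a - (φ (update R i P')).1 a =
      (φ (update (update R j Q) i P)).1 a - (φ (update (update R j Q) i P')).1 a := by
  -- Let `u` be the one of `a`, `b` that voter `j` prefers. The route is `R j`, `Q₁`, `Q₂`, `Q₃`,
  -- with consecutive preferences sharing the upper sets `upper u`, `{u}` and `[u, x]`; each
  -- contains `u` but not `v`.
  obtain ⟨u, v, huv, hw, hs'⟩ : ∃ u v, ((u = a ∧ v = b) ∨ (u = b ∧ v = a)) ∧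
      (R j).1.weak u v ∧ ((u < x ∧ x < v) ∨ (v < x ∧ x < u)) := by
    rcases (R j).1.total a b with h | h
    · exact ⟨a, b, Or.inl ⟨rfl, rfl⟩, h, hs⟩
    · exact ⟨b, a, Or.inr ⟨rfl, rfl⟩, h, hs.symm⟩
  have hne : u ≠ v := by grind
  have hvU : ¬ (R j).1.weak v u := fun h => hne ((R j).1.antisymm _ _ hw h)
  have hvx : v ∉ Finset.uIcc u x := by grind [Finset.mem_uIcc]
  have hux : u ∈ Finset.uIcc u x := Finset.left_mem_uIcc
  obtain ⟨Q₁, ht₁, hU₁⟩ := SPPref.exists_top_isUpper (c := u) (U := (R j).1.upper u)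
    ((StrictPref.mem_upper _).2 ((R j).1.refl u)) ((R j).ordConnected_upper u)
  obtain ⟨Q₂, ht₂, hU₂⟩ := SPPref.exists_top_isUpper (c := u) (U := Finset.uIcc u x) hux
    (by simpa using Set.ordConnected_uIcc)
  obtain ⟨Q₃, ht₃, hU₃⟩ := SPPref.exists_top_isUpper (c := x) (U := Finset.uIcc u x)
    Finset.right_mem_uIcc (by simpa using Set.ordConnected_uIcc)
  have sep : ∀ U : Finset (Fin m), u ∈ U → v ∉ U → (a ∈ U ∧ b ∉ U) ∨ (b ∈ U ∧ a ∉ U) := by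
    rintro U hu hv
    rcases huv with ⟨rfl, rfl⟩ | ⟨rfl, rfl⟩
    · exact Or.inl ⟨hu, hv⟩
    · exact Or.inr ⟨hu, hv⟩
  refine ⟨Q₃, ht₃, ?_⟩
  have e₁ := hφ.swap_eq_swap hswap R hij (Q := R j) ⟨u, rfl⟩ hU₁
    (sep _ ((StrictPref.mem_upper _).2 ((R j).1.refl u)) (by rwa [StrictPref.mem_upper]))
  have e₂ := hφ.swap_eq_swap hswap R hij (ht₁ ▸ Q₁.isUpper_top) (ht₂ ▸ Q₂.isUpper_top)
    (sep {u} (by simp) (by simpa using hne.symm))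
  have e₃ := hφ.swap_eq_swap hswap R hij hU₂ hU₃ (sep _ hux hvx)
  rw [update_eq_self] at e₁
  exact e₁.trans (e₂.trans e₃)

/-- Moving all other voters to the peak of `P` preserves the effect of the swap on `a`. There
unanimity gives `a` probability zero both before and after, so nothing is shifted. -/
theorem Unanimous.swap_invariant (hu : φ.Unanimous) (hφ : φ.StrategyProof)
    (hab : P.1.weak a b) (hs : (a < P.top ∧ P.top < b) ∨ (b < P.top ∧ P.top < a))
    (hadj : ∀ c, P.1.weak a c → P.1.weak c b → c = a ∨ c = b) (htop : P'.top = P.top)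
    (hP' : ∀ p p', P'.1.weak p p' ↔ (P.1.weak p p' ∧ ¬ (p = a ∧ p' = b)) ∨ (p = b ∧ p' = a))
    (R : Fin n → SPPref m) : φ (update R i P) = φ (update R i P') := by
  have hswap := fun R => hφ.swap_eq (i := i) hab hs hadj hP' R
  have key : ∀ s : Finset (Fin n), i ∉ s → ∃ S : Fin n → SPPref m, (∀ j ∈ s, (S j).top = P.top) ∧
      (φ (update R i P)).1 a - (φ (update R i P')).1 a =
        (φ (update S i P)).1 a - (φ (update S i P')).1 a := by
    intro s
    induction s using Finset.induction_on with
    | empty => exact fun _ => ⟨R, by simp, rfl⟩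
    | insert j s hj ih =>
      intro hi
      obtain ⟨S, hS, hSe⟩ := ih fun h => hi (Finset.mem_insert_of_mem h)
      have hji : j ≠ i := by
        rintro rfl
        exact hi (Finset.mem_insert_self _ _)
      obtain ⟨Q, hQ, hQe⟩ := hφ.exists_move hswap hs S hji
      refine ⟨update S j Q, fun k hk => ?_, hSe.trans hQe⟩
      by_cases hkj : k = j
      · rw [hkj, update_self, hQ]
      · rw [update_of_ne hkj]
        exact hS k ((Finset.mem_insert.1 hk).resolve_left hkj)
  obtain ⟨S, hS, hSe⟩ := key (Finset.univ.erase i) (Finset.notMem_erase _ _)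
  have hat := (SPPref.ne_top_of_swap hs).1
  have hzero : ∀ Q : SPPref m, Q.top = P.top → (φ (update S i Q)).1 a = 0 := by
    intro Q hQ
    refine Lottery.eq_zero_of_eq_one _ (hu P.top _ fun j => ?_) hat
    by_cases hji : j = i
    · rw [hji, update_self, hQ]
    · rw [update_of_ne hji]
      exact hS j (by simpa using hji)
  rw [hzero P rfl, hzero P' htop] at hSe
  obtain ⟨h1, h2⟩ := hswap R
  refine Subtype.ext (funext fun c => ?_)
  by_cases hca : c = a
  · rw [hca]
    linarith
  by_cases hcb : c = b
  · rw [hcb]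
    linarith
  exact h1 c hca hcb

end Swap

/-- A unanimous and strategy-proof rule depends only on the peaks. -/
theorem Unanimous.tops_only (hu : φ.Unanimous) (hφ : φ.StrategyProof) (R : Fin n → SPPref m)
    (i : Fin n) {P P' : SPPref m} (htop : P.top = P'.top) :
    φ (update R i P) = φ (update R i P') := by
  classical
  -- Induction on the number of ordered pairs on which `P` and `P'` disagree. A disagreement
  -- spanning the fewest projects in `P` is an adjacent pair, and swapping it lowers the number.
  induction hN : (Finset.univ.filter fun r : Fin m × Fin m =>
    P.1.weak r.1 r.2 ∧ ¬ P'.1.weak r.1 r.2).card using Nat.strong_induction_on generalizing P with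
  | _ N ih =>
    by_cases hne : (Finset.univ.filter fun r : Fin m × Fin m =>
        P.1.weak r.1 r.2 ∧ ¬ P'.1.weak r.1 r.2).Nonempty
    · obtain ⟨⟨a, b⟩, hmem, hmin⟩ := Finset.exists_min_image _
        (fun r : Fin m × Fin m =>
          (Finset.univ.filter fun c => P.1.weak r.1 c ∧ P.1.weak c r.2).card) hne
      simp only [Finset.mem_filter, Finset.mem_univ, true_and] at hmem hmin
      obtain ⟨hab, hab'⟩ := hmem
      have hba' : P'.1.weak b a := (P'.1.total _ _).resolve_left hab'
      have hadj : ∀ c, P.1.weak a c → P.1.weak c b → c = a ∨ c = b := by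
        intro c hac hcb
        by_contra! hc
        have hlt : ∀ u v : Fin m, P.1.weak a u → P.1.weak v b → (∃ w, P.1.weak a w ∧
            P.1.weak w b ∧ ¬ (P.1.weak u w ∧ P.1.weak w v)) →
            (Finset.univ.filter fun w => P.1.weak u w ∧ P.1.weak w v).card <
            (Finset.univ.filter fun w => P.1.weak a w ∧ P.1.weak w b).card := by
          rintro u v hu hv ⟨w, hw1, hw2, hw3⟩
          refine Finset.card_lt_card ⟨?_, ?_⟩
          · intro r hr
            simp only [Finset.mem_filter, Finset.mem_univ, true_and] at hr ⊢
            exact ⟨P.1.trans _ _ _ hu hr.1, P.1.trans _ _ _ hr.2 hv⟩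
          · intro h
            have := h (x := w) (by simpa using ⟨hw1, hw2⟩)
            exact hw3 (by simpa using this)
        by_cases h : P'.1.weak a c
        · refine absurd (hmin (c, b) ⟨hcb, fun h' => hab' (P'.1.trans _ _ _ h h')⟩) (not_le.2 ?_)
          exact hlt c b hac (P.1.refl b)
            ⟨a, P.1.refl a, hab, fun hh => hc.1 (P.1.antisymm _ _ hh.1 hac)⟩
        · refine absurd (hmin (a, c) ⟨hac, h⟩) (not_le.2 ?_)
          exact hlt a c (P.1.refl a) hcb
            ⟨b, hab, P.1.refl b, fun hh => hc.2 (P.1.antisymm _ _ hcb hh.2)⟩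
      -- On one side of the common peak both preferences would have to agree.
      have hs : (a < P.top ∧ P.top < b) ∨ (b < P.top ∧ P.top < a) := by
        have hanti := P.1.antisymm
        have hrefl := P'.1.refl
        have h1 := P'.weak_of_between (p := a) (p' := b)
        have h2 := P.weak_of_between (p := b) (p' := a)
        rw [← htop] at h1
        grind
      obtain ⟨P₁, ht, hP₁⟩ := P.exists_swap hab hs hadj
      rw [hu.swap_invariant hφ hab hs hadj ht hP₁ R]
      refine ih _ ?_ (ht.trans htop) rfl
      rw [← hN]
      refine Finset.card_lt_card ⟨?_, ?_⟩
      · rintro ⟨p, p'⟩ hr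
        simp only [Finset.mem_filter, Finset.mem_univ, true_and, hP₁] at hr ⊢
        grind
      · intro h
        have := h (x := (a, b)) (by simpa using ⟨hab, hab'⟩)
        simp only [Finset.mem_filter, Finset.mem_univ, true_and, hP₁] at this
        have hanti := P.1.antisymm
        grind
    · have hsub : ∀ p p', P.1.weak p p' → P'.1.weak p p' := by
        intro p p' h
        by_contra h'
        exact hne ⟨(p, p'), by simpa using ⟨h, h'⟩⟩
      have hPP : P = P' := by
        obtain ⟨⟨w, h1, h2, h3, h4⟩, h5⟩ := P
        obtain ⟨⟨w', h1', h2', h3', h4'⟩, h5'⟩ := P'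
        have : w = w' := by
          funext p p'
          refine propext ⟨hsub p p', fun h => ?_⟩
          rcases h2 p p' with h' | h'
          · exact h'
          · exact h3' _ _ h (hsub _ _ h') ▸ h1 p
        subst this
        rfl
      rw [hPP]

/-- Moving peaks to the left increases the probability of an initial segment. -/
theorem Unanimous.cum_update_le (hu : φ.Unanimous) (hφ : φ.StrategyProof) (R : Fin n → SPPref m)
    (i : Fin n) {P P' : SPPref m} {t : ℕ} (h : (P'.top : ℕ) < t → (P.top : ℕ) < t) :
    (φ (update R i P')).cum t ≤ (φ (update R i P)).cum t := by
  by_cases ht : (P.top : ℕ) < t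
  · obtain ⟨Q, hQ, hQU⟩ := SPPref.exists_top_isUpper (c := P.top)
      (U := Finset.univ.filter fun p => (p : ℕ) < t) (by simpa using ht)
      ⟨fun a ha b hb c hc => by
        have := hc.2
        simp only [Finset.coe_filter, Finset.mem_univ, true_and, Set.mem_ofPred_eq,
          Fin.le_def] at *
        omega⟩
    rw [hu.tops_only hφ R i hQ.symm]
    exact hφ.prob_le hQU
  · obtain ⟨Q, hQ, hQU⟩ := SPPref.exists_top_isUpper (c := P'.top)
      (U := (Finset.univ.filter fun p : Fin m => (p : ℕ) < t)ᶜ) (by simpa using fun h' => ht (h h'))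
      ⟨fun a ha b hb c hc => by
        have := hc.1
        simp only [Finset.coe_compl, Finset.coe_filter, Finset.mem_univ, true_and,
          Set.mem_compl_iff, Set.mem_ofPred_eq, Fin.le_def] at *
        omega⟩
    rw [hu.tops_only hφ R i hQ.symm, Lottery.cum, Lottery.cum]
    have h1 := hφ.prob_le (R := R) (i := i) (Q' := P) hQU
    have h2 := (φ (update R i P)).prob_add_prob_compl (Finset.univ.filter fun p => (p : ℕ) < t)
    have h3 := (φ (update R i Q)).prob_add_prob_compl (Finset.univ.filter fun p => (p : ℕ) < t)
    linarith

/-- Change the voters one at a time. -/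
theorem Unanimous.cum_le (hu : φ.Unanimous) (hφ : φ.StrategyProof) {R R' : Fin n → SPPref m}
    {t : ℕ} (h : ∀ i, ((R' i).top : ℕ) < t → ((R i).top : ℕ) < t) :
    (φ R').cum t ≤ (φ R).cum t := by
  classical
  have key : ∀ s : Finset (Fin n), (φ R').cum t ≤ (φ (s.piecewise R R')).cum t := by
    intro s
    induction s using Finset.induction_on with
    | empty => simp
    | insert j s hj ih =>
      refine ih.trans ?_
      rw [Finset.piecewise_insert]
      conv_lhs => rw [← update_eq_self j (s.piecewise R R')]
      refine hu.cum_update_le hφ _ j ?_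
      rw [Finset.piecewise_eq_of_notMem _ _ _ hj]
      exact h j
  simpa using key Finset.univ

theorem Unanimous.cum_eq (hu : φ.Unanimous) (hφ : φ.StrategyProof) {R R' : Fin n → SPPref m}
    {t : ℕ} (h : ∀ i, ((R' i).top : ℕ) < t ↔ ((R i).top : ℕ) < t) :
    (φ R').cum t = (φ R).cum t :=
  le_antisymm (hu.cum_le hφ fun i => (h i).1) (hu.cum_le hφ fun i => (h i).2)

end RSCR

/-! ### Counts per group, and profiles realizing them. -/

namespace VoterPartition

variable {n m g : ℕ} [NeZero m] (𝒩 : VoterPartition n g)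

theorem eq_of_mem {i : Fin n} {q r : Fin g} (hq : i ∈ 𝒩.part q) (hr : i ∈ 𝒩.part r) : q = r := by
  by_contra h
  exact Finset.disjoint_left.1 (𝒩.disjoint q r h) hq hr

/-- Two subsets with equally many voters from every group are related by a permutation that
preserves the groups. -/
theorem exists_perm (p p' : Fin n → Prop) [DecidablePred p] [DecidablePred p']
    (h : ∀ q, ((𝒩.part q).filter p).card = ((𝒩.part q).filter p').card) :
    ∃ π : Equiv.Perm (Fin n), (∀ q, ∀ i ∈ 𝒩.part q, π i ∈ 𝒩.part q) ∧ ∀ i, p' (π i) ↔ p i := by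
  choose grp hgrp using 𝒩.cover
  have hmem : ∀ i q, grp i = q ↔ i ∈ 𝒩.part q :=
    fun i q => ⟨fun h => h ▸ hgrp i, fun h => 𝒩.eq_of_mem (hgrp i) h⟩
  -- The fibres of voters over (group, truth value) have equal sizes, so bijections between them
  -- glue to the permutation.
  have hcard : ∀ c : Fin g × Bool, Nonempty ({i // (grp i, decide (p i)) = c} ≃
      {i // (grp i, decide (p' i)) = c}) := by
    rintro ⟨q, c⟩
    refine Fintype.card_eq.1 ?_
    rw [Fintype.card_subtype, Fintype.card_subtype]
    have h1 := h q
    have h2 := Finset.card_filter_add_card_filter_not (s := 𝒩.part q) p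
    have h3 := Finset.card_filter_add_card_filter_not (s := 𝒩.part q) p'
    have e : ∀ (r : Fin n → Prop) [DecidablePred r],
        (Finset.univ.filter fun i => (grp i, decide (r i)) = (q, c)) =
          (𝒩.part q).filter fun i => decide (r i) = c := by
      intro r _
      ext i
      simp [hmem]
    rw [e p, e p']
    cases c
    · simp only [decide_eq_false_iff_not]
      omega
    · simpa using h1
  let π := Equiv.ofFiberEquiv fun c => (hcard c).some
  have hπ : ∀ i, grp (π i) = grp i ∧ (p' (π i) ↔ p i) := by
    intro i
    have h := Equiv.ofFiberEquiv_map (fun c => (hcard c).some) i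
    rwa [Prod.mk.injEq, decide_eq_decide] at h
  refine ⟨π, fun q i hi => ?_, fun i => (hπ i).2⟩
  rw [← hmem] at hi ⊢
  exact (hπ i).1.trans hi

theorem exists_nested {γ γ' : GroupCounts 𝒩} (h : γ.Dominates γ') :
    ∃ S' S : Finset (Fin n), S' ⊆ S ∧ (∀ q, ((𝒩.part q).filter (· ∈ S')).card = γ' q) ∧
      ∀ q, ((𝒩.part q).filter (· ∈ S)).card = γ q := by
  have hex : ∀ q, ∃ A B : Finset (Fin n), A ⊆ B ∧ B ⊆ 𝒩.part q ∧ A.card = γ' q ∧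
      B.card = γ q := by
    intro q
    obtain ⟨B, hB, hBc⟩ := Finset.exists_subset_card_eq (Nat.le_of_lt_succ (γ q).2)
    obtain ⟨A, hA, hAc⟩ := Finset.exists_subset_card_eq (s := B) (n := γ' q) (hBc ▸ h q)
    exact ⟨A, B, hA, hB, hAc, hBc⟩
  choose A B hAB hB hAc hBc using hex
  have key : ∀ C : Fin g → Finset (Fin n), (∀ q, C q ⊆ 𝒩.part q) → ∀ q,
      (𝒩.part q).filter (· ∈ Finset.univ.biUnion C) = C q := by
    intro C hC q
    ext i
    simp only [Finset.mem_filter, Finset.mem_biUnion, Finset.mem_univ, true_and]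
    constructor
    · rintro ⟨hi, r, hr⟩
      rwa [𝒩.eq_of_mem hi (hC r hr)]
    · exact fun hi => ⟨hC q hi, q, hi⟩
  refine ⟨Finset.univ.biUnion A, Finset.univ.biUnion B,
    Finset.biUnion_mono fun q _ => hAB q, fun q => ?_, fun q => ?_⟩
  · rw [key A (fun q => (hAB q).trans (hB q)), hAc]
  · rw [key B hB, hBc]

end VoterPartition

section Counts

variable {n m g : ℕ} [NeZero m] {𝒩 : VoterPartition n g}

theorem peakCounts_eq_iff {t : ℕ} {R : Fin n → SPPref m} {γ : GroupCounts 𝒩} :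
    peakCounts 𝒩 t R = γ ↔
      ∀ q, ((𝒩.part q).filter fun i => ((R i).top : ℕ) < t).card = γ q := by
  rw [funext_iff]
  exact forall_congr' fun q => Fin.ext_iff

theorem peakCounts_dominates {t t' : ℕ} {R R' : Fin n → SPPref m}
    (h : ∀ i, ((R' i).top : ℕ) < t' → ((R i).top : ℕ) < t) :
    (peakCounts 𝒩 t R).Dominates (peakCounts 𝒩 t' R') := by
  intro q
  refine Fin.le_def.2 (Finset.card_le_card ?_)
  exact Finset.monotone_filter_right _ fun i _ => h i

/-- The profile with the given peaks. -/
theorem exists_profile {n : ℕ} (T : Fin n → Fin m) : ∃ R : Fin n → SPPref m, ∀ i, (R i).top = T i :=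
  ⟨fun i => (SPPref.exists_top (T i)).choose, fun i => (SPPref.exists_top (T i)).choose_spec⟩

/-- A set of voters with peak `p_1`, and the others with peak `p_m`. -/
theorem exists_extreme_profile {n : ℕ} (S : Finset (Fin n)) : ∃ R : Fin n → SPPref m,
    ∀ i, ((R i).top : ℕ) = if i ∈ S then 0 else m - 1 := by
  have hm := Nat.pos_of_ne_zero (NeZero.ne m)
  obtain ⟨R, hR⟩ := exists_profile (m := m) fun i : Fin n =>
    if i ∈ S then ⟨0, hm⟩ else ⟨m - 1, Nat.sub_one_lt hm.ne'⟩
  refine ⟨R, fun i => ?_⟩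
  rw [hR]
  split_ifs <;> rfl

theorem exists_ballotVoters (γ : GroupCounts 𝒩) :
    ∃ S : Finset (Fin n), ∀ q, ((𝒩.part q).filter (· ∈ S)).card = γ q := by
  obtain ⟨-, S, -, -, hS⟩ := 𝒩.exists_nested (γ := γ) (γ' := γ) fun _ => le_rfl
  exact ⟨S, hS⟩

/-- A profile with peaks in `{p_1, p_m}` at which the voters with peak `p_1` are counted by `γ`. -/
noncomputable def ballotProfile (m : ℕ) [NeZero m] (γ : GroupCounts 𝒩) : Fin n → SPPref m :=
  (exists_extreme_profile (m := m) (exists_ballotVoters γ).choose).choose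

theorem ballotProfile_top (γ : GroupCounts 𝒩) (i : Fin n) :
    ((ballotProfile m γ i).top : ℕ) = if i ∈ (exists_ballotVoters γ).choose then 0 else m - 1 :=
  (exists_extreme_profile (m := m) (exists_ballotVoters γ).choose).choose_spec i

/-- The counts do not vary strictly between `t = 0` and `t = m`. At these two ends the counts are
trivial, and so are the cumulative probabilities. -/
theorem peakCounts_extreme {S : Finset (Fin n)} {γ : GroupCounts 𝒩} {R : Fin n → SPPref m}
    (hS : ∀ q, ((𝒩.part q).filter (· ∈ S)).card = γ q)
    (hR : ∀ i, ((R i).top : ℕ) = if i ∈ S then 0 else m - 1) {t : ℕ} (h0 : 0 < t) (ht : t < m) :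
    peakCounts 𝒩 t R = γ := by
  rw [peakCounts_eq_iff]
  intro q
  rw [← hS q]
  congr 1
  refine Finset.filter_congr fun i _ => ?_
  rw [hR]
  split_ifs with h
  · simpa [h] using h0
  · simp only [h, iff_false]
    omega

theorem peakCounts_ballotProfile (γ : GroupCounts 𝒩) {t : ℕ} (h0 : 0 < t) (ht : t < m) :
    peakCounts 𝒩 t (ballotProfile m γ) = γ :=
  peakCounts_extreme (exists_ballotVoters γ).choose_spec (ballotProfile_top γ) h0 ht

end Counts

/-! ### From the axioms to ballots. -/

namespace RSCR

variable {n m g : ℕ} [NeZero m] {𝒩 : VoterPartition n g} {φ : RSCR n m}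

/-- Permuting voters within groups makes the same voters have their peaks in `[p_1, p_t]` in both
profiles. -/
theorem GroupAnonymous.cum_eq_of_peakCounts (ha : φ.GroupAnonymous 𝒩) (hu : φ.Unanimous)
    (hφ : φ.StrategyProof) {t : ℕ} {R R' : Fin n → SPPref m}
    (h : peakCounts 𝒩 t R = peakCounts 𝒩 t R') : (φ R).cum t = (φ R').cum t := by
  obtain ⟨π, hπ, hpp⟩ := 𝒩.exists_perm (fun i => ((R i).top : ℕ) < t)
    (fun i => ((R' i).top : ℕ) < t) fun q => Fin.ext_iff.1 (congrFun h q)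
  rw [ha π hπ R']
  exact hu.cum_eq hφ fun i => (hpp i).symm

theorem GroupAnonymous.cum_eq_cum_ballot (ha : φ.GroupAnonymous 𝒩) (hu : φ.Unanimous)
    (hφ : φ.StrategyProof) {t : ℕ} {R : Fin n → SPPref m} {γ : GroupCounts 𝒩}
    (h : 0 < t → t < m → peakCounts 𝒩 t R = γ) :
    (φ R).cum t = (φ (ballotProfile m γ)).cum t := by
  rcases Nat.eq_zero_or_pos t with rfl | h0
  · rw [Lottery.cum_zero, Lottery.cum_zero]
  rcases le_or_gt m t with ht | ht
  · rw [Lottery.cum_of_le _ ht, Lottery.cum_of_le _ ht]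
  · exact ha.cum_eq_of_peakCounts hu hφ ((h h0 ht).trans (peakCounts_ballotProfile γ h0 ht).symm)

theorem GroupAnonymous.isGroupBallotRule (ha : φ.GroupAnonymous 𝒩) (hu : φ.Unanimous)
    (hφ : φ.StrategyProof) : φ.IsGroupBallotRule 𝒩 fun γ => φ (ballotProfile m γ) where
  unanimity_bot := by
    refine hu _ _ fun i => Fin.ext ?_
    rw [ballotProfile_top, if_neg]
    intro hi
    obtain ⟨q, hq⟩ := 𝒩.cover i
    have h := (exists_ballotVoters (𝒩 := 𝒩) fun _ => 0).choose_spec q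
    rw [Fin.val_zero, Finset.card_eq_zero] at h
    exact Finset.notMem_empty i (h ▸ Finset.mem_filter.2 ⟨hq, hi⟩)
  unanimity_top := by
    refine hu _ _ fun i => Fin.ext ?_
    rw [ballotProfile_top, if_pos]
    obtain ⟨q, hq⟩ := 𝒩.cover i
    have h := (exists_ballotVoters (𝒩 := 𝒩) fun _ => Fin.last _).choose_spec q
    rw [Fin.val_last, Finset.card_filter_eq_iff] at h
    exact h i hq
  monotone := by
    intro γ γ' hγ t _ _
    obtain ⟨S', S, hSS, hS', hS⟩ := 𝒩.exists_nested hγ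
    obtain ⟨R, hR⟩ := exists_extreme_profile (m := m) S
    obtain ⟨R', hR'⟩ := exists_extreme_profile (m := m) S'
    rw [← ha.cum_eq_cum_ballot hu hφ (peakCounts_extreme hS hR),
      ← ha.cum_eq_cum_ballot hu hφ (peakCounts_extreme hS' hR')]
    refine hu.cum_le hφ fun i => ?_
    rw [hR, hR']
    by_cases hi : i ∈ S'
    · simp [hi, hSS hi]
    · rw [if_neg hi]
      split_ifs <;> omega
  outcome := by
    intro R p
    rw [← ha.cum_eq_cum_ballot hu hφ (R := R) fun _ _ => rfl,
      ← ha.cum_eq_cum_ballot hu hφ (R := R) fun _ _ => rfl, Lottery.cum_succ]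
    ring

end RSCR

theorem RepScenario.Compliant.exists_eq_Icc {n g m : ℕ} [NeZero m] {𝒩 : VoterPartition n g}
    {ψ : RepScenario 𝒩 m} {κ : Fin g → ℕ} (hψ : ψ.Compliant κ) (q : Fin g)
    (R : {i : Fin n // i ∈ 𝒩.part q} → SPPref m) :
    ∃ a b : Fin m, a ≤ b ∧ ψ q R = Finset.Icc a b ∧ (a : ℕ) + κ q = b + 1 := by
  obtain ⟨⟨a, b, hab⟩, hc⟩ := (hψ q).2 R
  refine ⟨a ⊓ b, a ⊔ b, inf_le_sup, hab, ?_⟩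
  rw [hab, Finset.uIcc, Fin.card_Icc] at hc
  have : ((a ⊓ b : Fin m) : ℕ) ≤ (a ⊔ b : Fin m) := Fin.le_def.1 inf_le_sup
  omega

theorem card_filter_part {n g : ℕ} (𝒩 : VoterPartition n g) (q : Fin g) (p : Fin n → Prop)
    [DecidablePred p] : (Finset.univ.filter fun i : {i // i ∈ 𝒩.part q} => p i).card =
      ((𝒩.part q).filter p).card := by
  rw [← Finset.card_map (Function.Embedding.subtype _)]
  congr 1
  ext i
  simp [and_comm]

/-! ### The entitlement guarantee, and the converse direction. -/

namespace RSCR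

variable {n m g : ℕ} [NeZero m] {𝒩 : VoterPartition n g} {φ : RSCR n m}
  {ψ : RepScenario 𝒩 m} {κ : Fin g → ℕ} {η : Fin g → ℝ}

/-- The guarantee is applied at a profile where the counts are `γ'` just before the represented
interval and `γ` at its end. -/
theorem WeakGEG.le_cum_sub_cum (hw : φ.WeakGEG ψ η) (hψ : ψ.Compliant κ)
    (ha : φ.GroupAnonymous 𝒩) (hu : φ.Unanimous) (hφ : φ.StrategyProof) {q : Fin g}
    {γ γ' : GroupCounts 𝒩} (hγ : γ.Dominates γ') {x : Fin m}
    (hx : (ψ q).Feasible (γ' q) (γ q) x) :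
    η q ≤ (φ (ballotProfile m γ)).cum (x + κ q) - (φ (ballotProfile m γ')).cum x := by
  obtain ⟨Q, b, hl, hg, h1, h2⟩ := hx
  obtain ⟨x', b', hxb, hψe, hκ⟩ := hψ.exists_eq_Icc q Q
  rw [hψe, Finset.coe_Icc] at hl hg
  obtain rfl := hl.unique (isLeast_Icc hxb)
  obtain rfl := hg.unique (isGreatest_Icc hxb)
  obtain ⟨S', S, hSS, hS', hS⟩ := 𝒩.exists_nested hγ
  have hm := Nat.pos_of_ne_zero (NeZero.ne m)
  -- Outside group `q`, voters in `S'` have their peaks before the interval, those in `S \ S'` in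
  -- it, and the rest after it. The degenerate cases, where `p_1` or `p_m` lies in the interval, are
  -- those excluded in `hlow` and `hhigh`.
  obtain ⟨R₀, hR₀⟩ := exists_profile (m := m) fun i : Fin n =>
    if i ∈ S' then ⟨0, hm⟩ else if i ∈ S then x else ⟨m - 1, Nat.sub_one_lt hm.ne'⟩
  let R : Fin n → SPPref m := fun i => if hi : i ∈ 𝒩.part q then Q ⟨i, hi⟩ else R₀ i
  have hRq : (fun i : {i // i ∈ 𝒩.part q} => R i.1) = Q := by
    funext i
    simp [R, i.2]
  have hRo : ∀ r, r ≠ q → ∀ i ∈ 𝒩.part r, R i = R₀ i := by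
    intro r hr i hi
    exact dif_neg fun hiq => hr (𝒩.eq_of_mem hi hiq)
  have hlow : 0 < (x : ℕ) → (x : ℕ) < m → peakCounts 𝒩 x R = γ' := by
    intro h0 _
    rw [peakCounts_eq_iff]
    intro r
    by_cases hr : r = q
    · subst hr
      rw [← h1, ← card_filter_part]
      simp_rw [congrFun hRq, Fin.lt_def]
    · rw [← hS']
      congr 1
      refine Finset.filter_congr fun i hi => ?_
      rw [hRo r hr i hi, hR₀]
      split_ifs with hi1 hi2
      · simpa [hi1] using h0
      · simp [hi1]
      · simp only [hi1, iff_false]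
        omega
  have hhigh : 0 < (x : ℕ) + κ q → (x : ℕ) + κ q < m → peakCounts 𝒩 (x + κ q) R = γ := by
    intro h0 hlt
    rw [peakCounts_eq_iff]
    intro r
    by_cases hr : r = q
    · subst hr
      have h3 := Finset.card_filter_add_card_filter_not
        (s := (Finset.univ : Finset {i // i ∈ 𝒩.part r})) (fun i => b < (Q i).top)
      rw [Finset.card_univ] at h3
      have h4 : (Finset.univ.filter fun i : {i // i ∈ 𝒩.part r} => ¬ b < (Q i).top) =
          Finset.univ.filter fun i : {i // i ∈ 𝒩.part r} => ((R i).top : ℕ) < x + κ r := by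
        refine Finset.filter_congr fun i _ => ?_
        rw [congrFun hRq i, hκ, not_lt, Fin.le_def, Nat.lt_succ_iff]
      rw [h4, card_filter_part 𝒩 r fun i => ((R i).top : ℕ) < x + κ r] at h3
      omega
    · rw [← hS]
      congr 1
      refine Finset.filter_congr fun i hi => ?_
      rw [hRo r hr i hi, hR₀]
      have := Fin.le_def.1 hxb
      split_ifs with hi1 hi2
      · simpa [hSS hi1] using h0
      · simp only [hi2, iff_true]
        omega
      · simp only [hi2, iff_false]
        omega
  rw [← ha.cum_eq_cum_ballot hu hφ hlow, ← ha.cum_eq_cum_ballot hu hφ hhigh, hκ,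
    ← Lottery.prob_Icc _ hxb, ← hψe, ← hRq]
  exact hw R q

namespace IsGroupBallotRule

variable {δ : GroupCounts 𝒩 → Lottery m}

/-- The outcome formula telescopes. -/
theorem cum_eq (h : φ.IsGroupBallotRule 𝒩 δ) (R : Fin n → SPPref m) {t : ℕ} (ht : t ≤ m) :
    (φ R).cum t = (δ (peakCounts 𝒩 t R)).cum t := by
  induction t with
  | zero => rw [Lottery.cum_zero, Lottery.cum_zero]
  | succ t ih =>
    have h1 := (φ R).cum_succ ⟨t, ht⟩
    have h2 := h.outcome R ⟨t, ht⟩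
    have h3 := ih (Nat.le_of_succ_le ht)
    simp only at h1 h2
    linarith

theorem cum_mono (h : φ.IsGroupBallotRule 𝒩 δ) {R R' : Fin n → SPPref m} {t : ℕ} (ht : t ≤ m)
    (hR : ∀ i, ((R' i).top : ℕ) < t → ((R i).top : ℕ) < t) : (φ R').cum t ≤ (φ R).cum t := by
  rcases Nat.eq_zero_or_pos t with rfl | h0
  · rw [Lottery.cum_zero, Lottery.cum_zero]
  rw [h.cum_eq R ht, h.cum_eq R' ht]
  exact h.monotone _ _ (peakCounts_dominates hR) t h0 ht

theorem unanimous (h : φ.IsGroupBallotRule 𝒩 δ) : φ.Unanimous := by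
  intro p R hR
  have h1 : (φ R).cum (p + 1) = 1 := by
    rw [h.cum_eq R p.2, peakCounts_eq_iff.2, Lottery.cum_eq_one _ h.unanimity_top (Nat.succ_pos _)]
    intro q
    rw [Fin.val_last, Finset.card_filter_eq_iff]
    intro i _
    rw [hR]
    exact Nat.lt_succ_self _
  have h2 : (φ R).cum p = 0 := by
    rw [h.cum_eq R p.2.le, peakCounts_eq_iff.2,
      Lottery.cum_eq_zero _ h.unanimity_bot (Nat.le_sub_one_of_lt p.2)]
    intro q
    rw [Fin.val_zero, Finset.card_eq_zero, Finset.filter_eq_empty_iff]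
    intro i _
    rw [hR]
    exact lt_irrefl _
  have := (φ R).cum_succ p
  linarith

/-- An upper contour set is an interval containing the true peak. A misreport can only lower the
cumulative probability at its right end and raise the one just before its left end. -/
theorem strategyProof (h : φ.IsGroupBallotRule 𝒩 δ) : φ.StrategyProof := by
  intro i R R' p
  have hmem : ∀ r, r ∈ (R i).1.upper p ↔ (R i).1.weak r p := fun r => StrictPref.mem_upper _
  have htop : (R i).top ∈ (R i).1.upper p := (hmem _).2 ((R i).1.weak_top p)
  have hne : ((R i).1.upper p).Nonempty := ⟨_, htop⟩
  have hIcc : (R i).1.upper p =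
      Finset.Icc (((R i).1.upper p).min' hne) (((R i).1.upper p).max' hne) := by
    ext r
    rw [Finset.mem_Icc]
    refine ⟨fun hr => ⟨Finset.min'_le _ _ hr, Finset.le_max' _ _ hr⟩, fun hr => ?_⟩
    exact ((R i).ordConnected_upper p).out (Finset.min'_mem _ hne) (Finset.max'_mem _ hne) hr
  have ha := Fin.le_def.1 (Finset.min'_le _ _ htop)
  have hb := Fin.le_def.1 (Finset.le_max' _ _ htop)
  rw [hIcc, Lottery.prob_Icc _ (Finset.min'_le_max' _ hne),
    Lottery.prob_Icc _ (Finset.min'_le_max' _ hne)]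
  refine sub_le_sub (h.cum_mono (Fin.is_lt _) fun j => ?_) (h.cum_mono (Fin.is_lt _).le fun j => ?_)
  · by_cases hj : j = i
    · subst hj
      exact fun _ => Nat.lt_succ_of_le hb
    · rw [Function.update_of_ne hj]
      exact id
  · by_cases hj : j = i
    · subst hj
      exact fun hlt => absurd hlt (not_lt.2 ha)
    · rw [Function.update_of_ne hj]
      exact id

theorem groupAnonymous (h : φ.IsGroupBallotRule 𝒩 δ) : φ.GroupAnonymous 𝒩 := by
  intro π hπ R
  refine Lottery.ext_cum fun t ht => ?_
  rw [h.cum_eq R ht, h.cum_eq _ ht]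
  congr 2
  rw [peakCounts_eq_iff]
  intro q
  refine (Finset.card_equiv π fun i => ?_).symm
  have hq : i ∈ 𝒩.part q ↔ π i ∈ 𝒩.part q := by
    refine ⟨hπ q i, fun hi => ?_⟩
    obtain ⟨r, hr⟩ := 𝒩.cover i
    rwa [𝒩.eq_of_mem hi (hπ r i hr)]
  simp only [Finset.mem_filter, hq]

theorem weakGEG (h : φ.IsGroupBallotRule 𝒩 δ) (hψ : ψ.Compliant κ)
    (hδ : ∀ (q : Fin g) (γ γ' : GroupCounts 𝒩), γ.Dominates γ' →
      ∀ x : Fin m, (ψ q).Feasible (γ' q) (γ q) x → (δ γ).cum (x + κ q) - (δ γ').cum x ≥ η q) :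
    φ.WeakGEG ψ η := by
  intro R q
  obtain ⟨a, b, hab, hψe, hκ⟩ := hψ.exists_eq_Icc q fun i => R i.1
  rw [hψe, Lottery.prob_Icc _ hab, ← hκ, h.cum_eq R (hκ ▸ b.2), h.cum_eq R a.2.le]
  -- The profile itself witnesses feasibility, with `γ'` and `γ` its counts before and up to the end
  -- of the interval.
  refine hδ q _ _ (peakCounts_dominates fun i hi => hi.trans_le (Nat.le_add_right _ _)) a
    ⟨fun i => R i.1, b, ?_, ?_, ?_, ?_⟩
  · rw [hψe, Finset.coe_Icc]
    exact isLeast_Icc hab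
  · rw [hψe, Finset.coe_Icc]
    exact isGreatest_Icc hab
  · exact card_filter_part 𝒩 q fun i => (R i).top < a
  · rw [card_filter_part 𝒩 q fun i => b < (R i).top, Fintype.card_coe]
    refine Eq.trans ?_
      (Finset.card_filter_add_card_filter_not (s := 𝒩.part q) fun i => b < (R i).top)
    refine congrArg (_ + ·) (congrArg Finset.card ?_)
    refine Finset.filter_congr fun i _ => ?_
    rw [hκ, not_lt, Fin.le_def, Nat.lt_succ_iff]

end IsGroupBallotRule

end RSCR

theorem mainTheorem4 {n m g : ℕ} [NeZero m] (hn : 2 ≤ n) (𝒩 : VoterPartition n g)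
    (κ : Fin g → ℕ) (hκ : ∀ q, 1 ≤ κ q ∧ κ q ≤ m)
    (η : Fin g → ℝ) (hη : ∀ q, 0 ≤ η q ∧ η q ≤ 1)
    (ψ : RepScenario 𝒩 m) (hψ : ψ.Compliant κ) (φ : RSCR n m) :
    (φ.Unanimous ∧ φ.StrategyProof ∧ φ.GroupAnonymous 𝒩 ∧ φ.WeakGEG ψ η) ↔
      ∃ δ : GroupCounts 𝒩 → Lottery m, φ.IsGroupBallotRule 𝒩 δ ∧
        ∀ (q : Fin g) (γ γ' : GroupCounts 𝒩), γ.Dominates γ' →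
          ∀ x : Fin m, (ψ q).Feasible (γ' q) (γ q) x →
            (δ γ).cum (x + κ q) - (δ γ').cum x ≥ η q := by
  constructor
  · rintro ⟨hu, hφ, ha, hw⟩
    exact ⟨fun γ => φ (ballotProfile m γ), ha.isGroupBallotRule hu hφ,
      fun q γ γ' hγ x hx => hw.le_cum_sub_cum hψ ha hu hφ hγ hx⟩
  · rintro ⟨δ, hδ, hη'⟩
    exact ⟨hδ.unanimous, hδ.strategyProof, hδ.groupAnonymous, hδ.weakGEG hψ hη'⟩
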